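/- A \emph{recursive tree} of size $n$ is a rooted non-plane tree on the $n$ labels $1,\dots,n$ whose labels increase along every path from the root to a leaf. A \emph{Pólya tree} is an unlabelled rooted non-plane tree, i.e. an isomorphism class of finite rooted trees; $|t|$ denotes the number of nodes of $t$, and $\mathcal P_{\le n}$ the set of Pólya trees with at most $n$ nodes. The fringe subtree of a tree at a node $v$ consists of $v$ and all its descendants, and its shape is the Pólya tree obtained by forgetting the labels. Let $X_n$ be the size of the compacted tree of a uniformly random recursive tree of size $n$, that is, the number of distinct shapes of its fringe subtrees. Let $T(z)$ be the exponential generating function of recursive trees and, for a Pólya tree $t$, let $S_t(z)$ be the exponential generating function of the recursive trees that have no fringe subtree of shape $t$. Let $\sigma\approx 0.338$ be the dominant singularity (the radius of convergence) of the ordinary generating function of Pólya trees, and let $\log$ denote the logarithm to base $1/\sigma$. Then, for all $n\ge 1$, \[ \mathbb E(X_n)=\sum_{\substack{t\in\mathcal P_{\le n}\\ |t|<\log n}}\Bigl(1-\frac{[z^n]S_t(z)}{[z^n]T(z)}\Bigr)+\sum_{\substack{t\in\mathcal P_{\le n}\\ |t|\ge\log n}}\Bigl(1-\frac{[z^n]S_t(z)}{[z^n]T(z)}\Bigr),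 \] and, as $n\to\infty$, the second sum satisfies \[ \sum_{\substack{t\in\mathcal P_{\le n}\\ |t|\ge\log n}}\Bigl(1-\frac{[z^n]S_t(z)}{[z^n]T(z)}\Bigr)=\Omega(\sqrt n). \] Consequently $\mathbb E(X_n)=\Omega(\sqrt n)$. Here $a_n=\Omega(b_n)$ means that there are $c>0$ and $N$ with $a_n\ge c\,b_n$ for all $n\ge N$. -/

import Mathlib

/-- A rooted (non-plane) tree on the vertex set `V`, given by its root and its parent map. By
convention the root is its own parent; every vertex reaches the root by iterating the parent map,
which makes the root the only fixed point and excludes cycles. -/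
@[ext]
structure ParentTree (V : Type*) where
  root : V
  parent : V → V
  parent_root : parent root = root
  reaches_root : ∀ v, ∃ m : ℕ, parent^[m] v = root

namespace ParentTree

/-- Isomorphism of rooted trees: a bijection of the vertices that respects roots and parents. -/
def Iso {V W : Type*} (T : ParentTree V) (T' : ParentTree W) : Prop :=
  ∃ e : V ≃ W, e T.root = T'.root ∧ ∀ v, e (T.parent v) = T'.parent (e v)

/-- The same tree with its vertices renamed along a bijection. -/
def relabel {V W : Type*} (T : ParentTree V) (e : V ≃ W) : ParentTree W where
  root := e T.root
  parent w := e (T.parent (e.symm w))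
  parent_root := by simp [T.parent_root]
  reaches_root w := by
    obtain ⟨m, hm⟩ := T.reaches_root (e.symm w)
    refine ⟨m, ?_⟩
    have h : Function.Semiconj e T.parent (fun w => e (T.parent (e.symm w))) := fun v => by simp
    have := (h.iterate_right m) (e.symm w)
    rw [hm] at this
    simpa using this.symm

/-- The vertices of the fringe subtree at `v`: the vertex `v` and all its descendants. -/
abbrev Descendant {V : Type*} (T : ParentTree V) (v : V) : Type _ :=
  {u : V // ∃ m : ℕ, T.parent^[m] u = v}

open Classical in
/-- The fringe subtree of `T` at `v`: the tree of all descendants of `v`, rooted at `v`. -/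
noncomputable def fringe {V : Type*} (T : ParentTree V) (v : V) :
    ParentTree (T.Descendant v) where
  root := ⟨v, 0, rfl⟩
  parent u := if h : u.1 = v then ⟨v, 0, rfl⟩ else ⟨T.parent u.1, by
    obtain ⟨m, hm⟩ := u.2
    cases m with
    | zero => exact absurd hm h
    | succ m => exact ⟨m, by simpa using hm⟩⟩
  parent_root := by simp
  reaches_root := by
    rintro ⟨u, m, hm⟩
    induction m generalizing u with
    | zero => exact ⟨0, Subtype.ext hm⟩
    | succ m ih =>
      by_cases h : u = v
      · exact ⟨0, Subtype.ext h⟩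
      · obtain ⟨j, hj⟩ := ih (T.parent u) (by simpa using hm)
        exact ⟨j + 1, by rw [Function.iterate_succ_apply, dif_neg h]; exact hj⟩

instance {V : Type*} [Finite V] : Finite (ParentTree V) :=
  Finite.of_injective (fun T : ParentTree V => (T.root, T.parent)) fun T T' h => by
    simp only [Prod.mk.injEq] at h
    exact ParentTree.ext h.1 h.2

/-- Isomorphism as an equivalence relation on the rooted trees with vertex set `V`. -/
def isoSetoid (V : Type*) : Setoid (ParentTree V) where
  r := Iso
  iseqv :=
    { refl := fun _ => ⟨Equiv.refl _, rfl, fun _ => rfl⟩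
      symm := by
        rintro T T' ⟨e, hr, hp⟩
        exact ⟨e.symm, by simp [← hr], fun w => by simp [Equiv.symm_apply_eq, hp]⟩
      trans := by
        rintro T T' T'' ⟨e, hr, hp⟩ ⟨f, hr', hp'⟩
        exact ⟨e.trans f, by simp [hr, hr'], fun v => by simp [hp, hp']⟩ }

end ParentTree

/-- Pólya trees (unlabelled rooted non-plane trees) with `k` nodes: isomorphism classes of rooted
trees on `k` vertices. -/
abbrev PolyaTreeOfSize (k : ℕ) : Type := Quotient (ParentTree.isoSetoid (Fin k))

noncomputable instance (k : ℕ) : Fintype (PolyaTreeOfSize k) := Fintype.ofFinite _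

/-- The class of all Pólya trees. -/
abbrev PolyaTree : Type := Σ k : ℕ, PolyaTreeOfSize k

/-- The size (number of nodes) of a Pólya tree. -/
def PolyaTree.size (t : PolyaTree) : ℕ := t.1

/-- The finite set of all Pólya trees of size at most `n`. -/
noncomputable def polyaTreesLE (n : ℕ) : Finset PolyaTree :=
  (Finset.range (n + 1)).sigma fun _ => Finset.univ

/-- The shape of a finite rooted tree: the Pólya tree obtained by forgetting vertex names. -/
noncomputable def ParentTree.shape {V : Type*} [Finite V] (T : ParentTree V) : PolyaTree :=
  ⟨Nat.card V, Quotient.mk (ParentTree.isoSetoid _) (T.relabel (Finite.equivFin V))⟩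

/-- Recursive trees of size `n`: rooted non-plane trees on `n` linearly ordered labels whose labels
increase along every path from the root to a leaf. -/
abbrev RecursiveTree (n : ℕ) : Type :=
  {T : ParentTree (Fin n) // ∀ v, v ≠ T.root → T.parent v < v}

noncomputable instance (n : ℕ) : Fintype (RecursiveTree n) := Fintype.ofFinite _

/-- The Pólya tree `t` is the shape of some fringe subtree of the recursive tree `τ`. -/
def Occurs {n : ℕ} (t : PolyaTree) (τ : RecursiveTree n) : Prop :=
  ∃ v : Fin n, (τ.1.fringe v).shape = t

/-- The size of the compacted tree of `τ`: the number of distinct shapes of fringe subtrees. -/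
noncomputable def compactedSize {n : ℕ} (τ : RecursiveTree n) : ℕ :=
  Set.ncard {t : PolyaTree | Occurs t τ}

/-- The expectation of the compacted size for a uniformly random recursive tree of size `n`. -/
noncomputable def expectedCompactedSize (n : ℕ) : ℝ :=
  (∑ τ : RecursiveTree n, (compactedSize τ : ℝ)) / Nat.card (RecursiveTree n)

/-- The exponential generating function of recursive trees. -/
noncomputable def recursiveEGF : PowerSeries ℝ :=
  PowerSeries.mk fun n => (Nat.card (RecursiveTree n) : ℝ) / n.factorial

/-- The exponential generating function of the recursive trees that have no fringe subtree of
shape `t`. -/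
noncomputable def avoidingEGF (t : PolyaTree) : PowerSeries ℝ :=
  PowerSeries.mk fun n => (Nat.card {τ : RecursiveTree n // ¬ Occurs t τ} : ℝ) / n.factorial

/-- The dominant singularity of the ordinary generating function of Pólya trees. The coefficients
being nonnegative, it is the radius of convergence of this series. -/
noncomputable def polyaSingularity : ℝ :=
  (FormalMultilinearSeries.ofScalars ℂ
    (fun k : ℕ => (Nat.card (PolyaTreeOfSize k) : ℂ))).radius.toReal

/-- The logarithm to base `1 / σ`, where `σ` is the dominant singularity of the generating function
of Pólya trees. -/
noncomputable def polyaLog (x : ℝ) : ℝ := Real.logb (1 / polyaSingularity) x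

/-- The summand `1 - [zⁿ] S_t(z) / [zⁿ] T(z)`: the probability that `t` occurs as the shape of a
fringe subtree of a uniformly random recursive tree of size `n`. -/
noncomputable def shapeContribution (n : ℕ) (t : PolyaTree) : ℝ :=
  1 - PowerSeries.coeff n (avoidingEGF t) / PowerSeries.coeff n recursiveEGF

open Classical in
/-- The contribution of the shapes `t` of size at most `n` with `|t| < log n`. -/
noncomputable def smallShapeSum (n : ℕ) : ℝ :=
  ∑ t ∈ (polyaTreesLE n).filter (fun t => (t.size : ℝ) < polyaLog n), shapeContribution n t

open Classical in
/-- The contribution of the shapes `t` of size at most `n` with `|t| ≥ log n`. -/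
noncomputable def largeShapeSum (n : ℕ) : ℝ :=
  ∑ t ∈ (polyaTreesLE n).filter (fun t => polyaLog n ≤ (t.size : ℝ)), shapeContribution n t

/-! Summing the occurrence probabilities of shapes gives the expected number of distinct shapes,
hence the identity. For the lower bound, fringe subtrees of different sizes have different shapes,
so it suffices to find many sizes.

Grow the tree by attaching each new node to a uniform earlier one. With `2h` nodes present, a node
of `[h, 2h)` is a leaf with probability at least `1/2` (`card_childless`). From then on the
descendants of the first `2h` nodes evolve as a Pólya urn: each newcomer joins the block of its
parent. The joint law of two block sizes is nonincreasing in each size (`jointCount_antitone`), so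
two blocks have equal size with probability at most that of one having size 1, which is `(2h-1)/n`
(`card_collision_le`). There are fewer than `h^2` ordered pairs, so for `16h^2 ≤ n+1` at most `h/4`
collisions are expected, against at least `h/2` leaves: on average at least `h/4` sizes differ. Take
`h` near `√n/4`; discarding the sizes below `log n` costs only `o(√n)`. -/

open Finset

/-! ### Attachment sequences -/

open Classical in
/-- The parent maps on the nodes `0, …, n` obtained by successively attaching the nodes
`1, …, n` to earlier nodes (extended by zero beyond `n`). -/
noncomputable def attachSeqs : ℕ → Finset (ℕ → ℕ)
  | 0 => {0}
  | n + 1 => (attachSeqs n ×ˢ range (n + 1)).image fun x => Function.update x.1 (n + 1) x.2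

theorem mem_attachSeqs {n : ℕ} {p : ℕ → ℕ} :
    p ∈ attachSeqs n ↔ p 0 = 0 ∧ (∀ v, 0 < v → v ≤ n → p v < v) ∧ ∀ v, n < v → p v = 0 := by
  induction n generalizing p with
  | zero =>
    simp only [attachSeqs, mem_singleton]
    constructor
    · rintro rfl
      refine ⟨rfl, fun v h0 h1 => by omega, fun _ _ => rfl⟩
    · rintro ⟨h0, -, h⟩
      funext v
      rcases Nat.eq_zero_or_pos v with rfl | hv
      · exact h0
      · exact h v hv
  | succ n ih =>
    simp only [attachSeqs, mem_image, mem_product, mem_range, Prod.exists]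
    constructor
    · rintro ⟨p, q, ⟨hp, hq⟩, rfl⟩
      obtain ⟨h0, h1, h2⟩ := ih.1 hp
      refine ⟨by simp [Function.update, h0], fun v hv hvn => ?_, fun v hv => ?_⟩
      · by_cases h : v = n + 1
        · subst h; simpa using hq
        · rw [Function.update_of_ne h]; exact h1 v hv (by omega)
      · rw [Function.update_of_ne (by omega)]; exact h2 v (by omega)
    · rintro ⟨h0, h1, h2⟩
      refine ⟨Function.update p (n + 1) 0, p (n + 1), ⟨ih.2 ⟨?_, fun v hv hvn => ?_, fun v hv => ?_⟩,
        h1 _ (by omega) le_rfl⟩, by simp⟩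
      · simp [Function.update, h0]
      · rw [Function.update_of_ne (by omega)]; exact h1 v hv (by omega)
      · by_cases h : v = n + 1
        · subst h; simp
        · rw [Function.update_of_ne h]; exact h2 v (by omega)

/-- The value at `n + 1` recovers the last choice, and the zero convention beyond `n` recovers the
rest, so no sequence is counted twice. -/
theorem sum_attachSeqs_succ {M : Type*} [AddCommMonoid M] (n : ℕ) (g : (ℕ → ℕ) → M) :
    ∑ p ∈ attachSeqs (n + 1), g p =
      ∑ p ∈ attachSeqs n, ∑ q ∈ range (n + 1), g (Function.update p (n + 1) q) := by
  classical
  rw [attachSeqs, sum_image, sum_product]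
  rintro ⟨p, q⟩ hx ⟨p', q'⟩ hx' h
  simp only [coe_product, Set.mem_prod, mem_coe] at hx hx' h
  have hq : q = q' := by simpa using congrFun h (n + 1)
  refine Prod.ext (funext fun v => ?_) hq
  by_cases hv : v = n + 1
  · subst hv
    exact ((mem_attachSeqs.1 hx.1).2.2 _ (by omega)).trans
      ((mem_attachSeqs.1 hx'.1).2.2 _ (by omega)).symm
  · simpa [Function.update_of_ne hv] using congrFun h v

theorem card_attachSeqs (n : ℕ) : (attachSeqs n).card = n.factorial := by
  induction n with
  | zero => rfl
  | succ n ih =>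
    rw [card_eq_sum_ones, sum_attachSeqs_succ]
    simp [ih, Nat.factorial_succ, mul_comm]

-- Node `w` avoids `i` with probability `(w-1)/w`; the product over `s < w ≤ e` telescopes to `s/e`.
open Classical in
theorem card_childless (n : ℕ) {i s e : ℕ} (hi : i ≤ s) (hse : s ≤ e) (hen : e ≤ n) :
    #{p ∈ attachSeqs n | ∀ w, s < w → w ≤ e → p w ≠ i} * e = n.factorial * s := by
  induction n generalizing e with
  | zero =>
    obtain rfl : e = 0 := by omega
    obtain rfl : s = 0 := by omega
    simp
  | succ n ih =>
    rcases hse.eq_or_lt with rfl | hlt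
    · rw [filter_true_of_mem (fun p _ w h1 h2 => absurd h2 (by omega)), card_attachSeqs]
    rw [card_filter, sum_attachSeqs_succ]
    -- If `e = n + 1` the last node has `n` choices other than `i`; otherwise it is unconstrained
    -- and has `n + 1`.
    rcases hen.eq_or_lt with rfl | hen
    · have key : ∀ p ∈ attachSeqs n, ∑ q ∈ range (n + 1),
          (if ∀ w, s < w → w ≤ n + 1 → Function.update p (n + 1) q w ≠ i then 1 else 0) =
          (if ∀ w, s < w → w ≤ n → p w ≠ i then 1 else 0) * n := by
        intro p _
        have : ∀ q, (∀ w, s < w → w ≤ n + 1 → Function.update p (n + 1) q w ≠ i) ↔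
            (∀ w, s < w → w ≤ n → p w ≠ i) ∧ q ≠ i := by
          intro q
          constructor
          · refine fun h => ⟨fun w h1 h2 => ?_, by simpa using h (n + 1) (by omega) le_rfl⟩
            simpa [Function.update_of_ne (show w ≠ n + 1 by omega)] using h w h1 (by omega)
          · rintro ⟨h, hq⟩ w h1 h2
            by_cases hw : w = n + 1
            · subst hw; simpa using hq
            · rw [Function.update_of_ne hw]; exact h w h1 (by omega)
        simp only [this]
        by_cases h : ∀ w, s < w → w ≤ n → p w ≠ i
        · simp only [if_pos h, and_iff_right h, ← card_filter, one_mul]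
          rw [filter_ne', card_erase_of_mem (mem_range.2 (by omega)), card_range]
          simp
        · simp [h]
      rw [sum_congr rfl key, ← sum_mul, ← card_filter, ih (by omega) le_rfl, Nat.factorial_succ]
      ring
    · have key : ∀ p ∈ attachSeqs n, ∑ q ∈ range (n + 1),
          (if ∀ w, s < w → w ≤ e → Function.update p (n + 1) q w ≠ i then 1 else 0) =
          (if ∀ w, s < w → w ≤ e → p w ≠ i then 1 else 0) * (n + 1) := by
        intro p _
        have : ∀ q, (∀ w, s < w → w ≤ e → Function.update p (n + 1) q w ≠ i) ↔
            (∀ w, s < w → w ≤ e → p w ≠ i) := fun q =>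
          forall_congr' fun w => imp_congr_right fun _ => ⟨fun h h2 => by
            simpa [Function.update_of_ne (show w ≠ n + 1 by omega)] using h h2, fun h h2 => by
            simpa [Function.update_of_ne (show w ≠ n + 1 by omega)] using h h2⟩
        simp only [this]
        simp [mul_comm]
      rw [sum_congr rfl key, ← sum_mul, ← card_filter, mul_right_comm, ih hlt.le (by omega),
        Nat.factorial_succ]
      ring

/-! ### Colour blocks as a Pólya urn -/

/-- The last node before `m` on the way from `v` towards the root. -/
def color (m : ℕ) (p : ℕ → ℕ) (v : ℕ) : ℕ :=
  if v < m then v else if p v < v then color m p (p v) else 0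
termination_by v

theorem color_of_lt {m v : ℕ} (p : ℕ → ℕ) (h : v < m) : color m p v = v := by
  rw [color, if_pos h]

theorem color_of_le {m v : ℕ} {p : ℕ → ℕ} (h : m ≤ v) (hp : p v < v) :
    color m p v = color m p (p v) := by
  rw [color, if_neg (by omega), if_pos hp]

theorem color_congr {m n : ℕ} {p p' : ℕ → ℕ} (h : ∀ v ≤ n, p v = p' v) {v : ℕ} (hv : v ≤ n) :
    color m p v = color m p' v := by
  induction v using Nat.strong_induction_on with
  | _ v ih =>
    rw [color, color.eq_def m p', h v hv]
    split_ifs with h1 h2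
    · rfl
    · exact ih _ h2 (by omega)
    · rfl

/-- The number of nodes `v ≤ n` of colour `i`. -/
def blockSize (m n : ℕ) (p : ℕ → ℕ) (i : ℕ) : ℕ := #{v ∈ range (n + 1) | color m p v = i}

theorem blockSize_update {m n : ℕ} (p : ℕ → ℕ) {q : ℕ} (hm : m ≤ n + 1) (hq : q < n + 1) (i : ℕ) :
    blockSize m (n + 1) (Function.update p (n + 1) q) i =
      blockSize m n p i + if color m p q = i then 1 else 0 := by
  have hc : ∀ v ≤ n, color m (Function.update p (n + 1) q) v = color m p v := fun v hv =>
    color_congr (n := n) (fun u hu => Function.update_of_ne (by omega) _ _) hv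
  have h1 : color m (Function.update p (n + 1) q) (n + 1) = color m p q := by
    rw [color_of_le hm (by simpa using hq), Function.update_self, hc q (by omega)]
  rw [blockSize, card_filter, sum_range_succ, h1, blockSize, card_filter]
  congr 1
  exact sum_congr rfl fun v hv => by rw [hc v (by simp at hv; omega)]

theorem one_le_blockSize {m n i : ℕ} (p : ℕ → ℕ) (hi : i < m) (hin : i ≤ n) :
    1 ≤ blockSize m n p i :=
  card_pos.2 ⟨i, by simp [color_of_lt p hi]; omega⟩

theorem blockSize_le (m n : ℕ) (p : ℕ → ℕ) (i : ℕ) : blockSize m n p i ≤ n + 1 :=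
  (card_filter_le _ _).trans (card_range _).le

theorem blockSize_add_le (m n : ℕ) (p : ℕ → ℕ) {i j : ℕ} (hij : i ≠ j) :
    blockSize m n p i + blockSize m n p j ≤ n + 1 := by
  rw [blockSize, blockSize, ← card_union_of_disjoint]
  · exact (card_le_card (union_subset (filter_subset _ _) (filter_subset _ _))).trans
      (card_range _).le
  · exact disjoint_filter.2 fun v _ h h' => hij (h.symm.trans h')

/-- One urn step: the newcomer's parent lies in block `i`, in block `j` or in neither, with weights
given by the block sizes. -/
theorem sum_range_color (m n : ℕ) (p : ℕ → ℕ) {i j : ℕ} (hij : i ≠ j) (F : ℕ → ℕ → ℕ) (x y : ℕ) :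
    ∑ q ∈ range (n + 1),
        F (x + if color m p q = i then 1 else 0) (y + if color m p q = j then 1 else 0) =
      blockSize m n p i * F (x + 1) y + blockSize m n p j * F x (y + 1) +
        (n + 1 - (blockSize m n p i + blockSize m n p j)) * F x y := by
  have hle := blockSize_add_le m n p hij
  have hF : ∀ q, F (x + if color m p q = i then 1 else 0) (y + if color m p q = j then 1 else 0)
      = (if color m p q = i then F (x + 1) y else 0) + (if color m p q = j then F x (y + 1) else 0)
        + if color m p q ≠ i ∧ color m p q ≠ j then F x y else 0 := by
    intro q
    by_cases h1 : color m p q = i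
    · have h2 : color m p q ≠ j := fun h => hij (h1.symm.trans h)
      simp [h1, hij]
    · by_cases h2 : color m p q = j
      · simp [h2, hij.symm]
      · simp [h1, h2]
  have h3 : #{q ∈ range (n + 1) | color m p q ≠ i ∧ color m p q ≠ j} =
      n + 1 - (blockSize m n p i + blockSize m n p j) := by
    have h := sum_congr (M := ℕ) (s₁ := range (n + 1)) rfl fun q _ =>
      (show 1 = (if color m p q = i then 1 else 0) + (if color m p q = j then 1 else 0)
        + if color m p q ≠ i ∧ color m p q ≠ j then 1 else 0 by
          by_cases h1 : color m p q = i
          · simp [h1, hij]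
          · by_cases h2 : color m p q = j <;> simp [h1, h2, hij.symm])
    rw [sum_add_distrib, sum_add_distrib, ← card_filter, ← card_filter, ← card_filter] at h
    simp only [sum_const, card_range, smul_eq_mul, mul_one] at h
    rw [blockSize, blockSize]
    omega
  simp only [hF, sum_add_distrib, ← sum_filter, sum_const, smul_eq_mul]
  rw [h3, blockSize, blockSize]

/-! ### Joint law of two block sizes -/

/-- The number of attachment sequences whose blocks `i` and `j` have sizes `a` and `b`. -/
noncomputable def jointCount (m n i j a b : ℕ) : ℕ :=
  #{p ∈ attachSeqs n | blockSize m n p i = a ∧ blockSize m n p j = b}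

theorem jointCount_succ {m n i j : ℕ} (hm : m ≤ n + 1) (hij : i ≠ j) (a b : ℕ) :
    jointCount m (n + 1) i j (a + 1) (b + 1) =
      a * jointCount m n i j a (b + 1) + b * jointCount m n i j (a + 1) b +
        (n + 1 - (a + 1 + (b + 1))) * jointCount m n i j (a + 1) (b + 1) := by
  simp only [jointCount, card_filter, mul_sum, ← sum_add_distrib]
  rw [sum_attachSeqs_succ]
  refine sum_congr rfl fun p _ => ?_
  have h := sum_range_color m n p hij (fun x y => if x = a + 1 ∧ y = b + 1 then 1 else 0)
    (blockSize m n p i) (blockSize m n p j)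
  rw [sum_congr rfl fun q hq => by
    rw [blockSize_update p hm (mem_range.1 hq), blockSize_update p hm (mem_range.1 hq)]]
  rw [h]
  congr 1
  · congr 1
    · by_cases h : blockSize m n p i = a ∧ blockSize m n p j = b + 1
      · simp [h]
      · rw [if_neg h, if_neg (by omega)]; rfl
    · by_cases h : blockSize m n p i = a + 1 ∧ blockSize m n p j = b
      · simp [h]
      · rw [if_neg h, if_neg (by omega)]; rfl
  · by_cases h : blockSize m n p i = a + 1 ∧ blockSize m n p j = b + 1
    · simp [h]
    · simp [h]

/-- One of the nodes 0, 1, 2 differs from `i` and `j` and carries its own colour, so the two blocks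
miss it. -/
theorem jointCount_eq_zero {m n i j : ℕ} (hm : 3 ≤ m) (hmn : m ≤ n + 1) (hij : i ≠ j) {a b : ℕ}
    (h : n + 1 ≤ a + b) : jointCount m n i j a b = 0 := by
  rw [jointCount, card_eq_zero, filter_eq_empty_iff]
  rintro p - ⟨rfl, rfl⟩
  obtain ⟨k, hk, hki, hkj⟩ : ∃ k < 3, k ≠ i ∧ k ≠ j := by
    by_cases h0 : i = 0 ∨ j = 0
    · by_cases h1 : i = 1 ∨ j = 1
      · exact ⟨2, by omega⟩
      · exact ⟨1, by omega⟩
    · exact ⟨0, by omega⟩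
  have hlt : blockSize m n p i + blockSize m n p j < #(range (n + 1)) := by
    rw [blockSize, blockSize, ← card_union_of_disjoint
      (disjoint_filter.2 fun v _ h h' => hij (h.symm.trans h'))]
    refine card_lt_card (Finset.ssubset_iff_subset_ne.2
      ⟨union_subset (filter_subset _ _) (filter_subset _ _), fun he => ?_⟩)
    have hmem : k ∈ range (n + 1) := mem_range.2 (by omega)
    rw [← he] at hmem
    simp [color_of_lt p (show k < m by omega), hki, hkj] at hmem
  rw [card_range] at hlt
  omega

/-- Induction on `n` through the urn recurrence. Passing from `b + 1` to `b + 2` moves one unit of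
weight from the third term to the second, and the induction hypothesis compares what remains. With
only two blocks the sizes would sum to `n + 1` and monotonicity would fail, hence `3 ≤ m`. -/
theorem jointCount_antitone {m n i j : ℕ} (hm3 : 3 ≤ m) (hi : i < m) (hm : m ≤ n + 1)
    (hij : i ≠ j) (a b : ℕ) :
    jointCount m n i j a (b + 2) ≤ jointCount m n i j a (b + 1) := by
  induction n, (show m - 1 ≤ n by omega) using Nat.le_induction generalizing a b with
  -- With only the first `m` nodes present every block has at most one element.
  | base =>
    suffices h : jointCount m (m - 1) i j a (b + 2) = 0 by omega
    rw [jointCount, card_eq_zero, filter_eq_empty_iff]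
    rintro p - ⟨-, h⟩
    have : blockSize m (m - 1) p j ≤ 1 := by
      refine (card_le_card (t := {j}) fun v hv => ?_).trans (card_singleton j).le
      simp only [mem_filter, mem_range] at hv
      rw [color_of_lt p (by omega)] at hv
      simp [hv.2]
    omega
  | succ n hn ih =>
    have ih := fun a b => ih (by omega) a b
    cases a with
    | zero =>
      suffices h : jointCount m (n + 1) i j 0 (b + 2) = 0 by omega
      rw [jointCount, card_eq_zero, filter_eq_empty_iff]
      rintro p - ⟨h, -⟩
      have := one_le_blockSize (n := n + 1) p hi (by omega)
      omega
    | succ a =>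
      rw [jointCount_succ (by omega) hij, jointCount_succ (by omega) hij]
      have h1 := Nat.mul_le_mul_left a (ih a b)
      have h3 := ih (a + 1) b
      -- The subtraction in the recurrence truncates here, but the counts it multiplies vanish.
      rcases le_or_gt (n + 1) (a + 1 + (b + 1)) with hge | hlt
      · have h0 := jointCount_eq_zero hm3 (by omega) hij hge
        rw [h0] at h3 ⊢
        rw [show b + 1 + 1 = b + 2 from rfl, Nat.le_zero.1 h3]
        simp only [mul_zero, add_zero]
        omega
      · obtain ⟨d, hd⟩ := Nat.exists_eq_add_of_lt hlt
        have e1 : n + 1 - (a + 1 + (b + 1 + 1)) = d := by omega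
        have e2 : n + 1 - (a + 1 + (b + 1)) = d + 1 := by omega
        rw [e1, e2]
        have h4 : b * jointCount m n i j (a + 1) (b + 1) ≤ b * jointCount m n i j (a + 1) b := by
          cases b with
          | zero => simp
          | succ b => exact Nat.mul_le_mul_left _ (ih (a + 1) b)
        nlinarith [Nat.mul_le_mul_left d h3]

theorem jointCount_le {m n i j : ℕ} (hm3 : 3 ≤ m) (hi : i < m) (hm : m ≤ n + 1)
    (hij : i ≠ j) (a b : ℕ) :
    jointCount m n i j a (b + 1) ≤ jointCount m n i j a 1 := by
  induction b with
  | zero => rfl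
  | succ b ih => exact (jointCount_antitone hm3 hi hm hij a b).trans ih

-- For each `a`, monotonicity bounds the count of sizes `(a, a)` by that of `(a, 1)`. Summing over
-- `a` leaves the event that block `j` is a singleton, so that `j` gets no child from `m` on.
open Classical in
theorem card_collision_le {m n i j : ℕ} (hm3 : 3 ≤ m) (hi : i < m) (hm : m ≤ n + 1)
    (hj : j < m) (hij : i ≠ j) :
    #{p ∈ attachSeqs n | blockSize m n p i = blockSize m n p j} * n ≤ n.factorial * (m - 1) := by
  rw [← card_childless n (show j ≤ m - 1 by omega) (show m - 1 ≤ n by omega) le_rfl]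
  refine Nat.mul_le_mul_right n ?_
  have hmaps : ∀ p ∈ ({p ∈ attachSeqs n | blockSize m n p j = 1} : Finset _),
      blockSize m n p i ∈ range (n + 2) := fun p _ =>
    mem_range.2 (Nat.lt_succ_of_le (blockSize_le m n p i))
  have hmaps' : ∀ p ∈ ({p ∈ attachSeqs n | blockSize m n p i = blockSize m n p j} : Finset _),
      blockSize m n p i ∈ range (n + 2) := fun p _ =>
    mem_range.2 (Nat.lt_succ_of_le (blockSize_le m n p i))
  calc #{p ∈ attachSeqs n | blockSize m n p i = blockSize m n p j}
      ≤ #{p ∈ attachSeqs n | blockSize m n p j = 1} := by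
        rw [card_eq_sum_card_fiberwise hmaps, card_eq_sum_card_fiberwise hmaps']
        refine sum_le_sum fun a _ => ?_
        cases a with
        | zero =>
          rw [card_eq_zero.2]
          · exact Nat.zero_le _
          · rw [filter_eq_empty_iff]
            intro p _ h
            have := one_le_blockSize (n := n) p hi (by omega)
            omega
        | succ a =>
          calc _ = jointCount m n i j (a + 1) (a + 1) := by
                rw [filter_filter, jointCount]
                congr 1
                exact filter_congr fun p _ => by omega
            _ ≤ jointCount m n i j (a + 1) 1 := jointCount_le hm3 hi hm hij _ _
            _ = _ := by
                rw [filter_filter, jointCount]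
                congr 1
                exact filter_congr fun p _ => by omega
    _ ≤ _ := by
        refine card_le_card fun p hp => ?_
        simp only [mem_filter] at hp ⊢
        refine ⟨hp.1, fun w h1 h2 h => ?_⟩
        have hpw := (mem_attachSeqs.1 hp.1).2.1 w (by omega) h2
        have hcw : color m p w = j := by
          rw [color_of_le (by omega) hpw, h, color_of_lt p hj]
        have : 1 < blockSize m n p j := one_lt_card.2
          ⟨j, by simp [color_of_lt p hj]; omega, w, by simp [hcw]; omega, by omega⟩
        omega

/-- A node other than `i` can reach `i` only through a child of `i`. All these are at least `m`, so
`i` is then the first node below `m` on the path. -/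
theorem exists_iterate_eq_iff_color {m n : ℕ} {p : ℕ → ℕ} (hp : p ∈ attachSeqs n) {i : ℕ}
    (hi : i < m) (hleaf : ∀ w, i < w → w < m → p w ≠ i) {v : ℕ} (hv : v ≤ n) :
    (∃ k, p^[k] v = i) ↔ color m p v = i := by
  obtain ⟨h0, h1, -⟩ := mem_attachSeqs.1 hp
  induction v using Nat.strong_induction_on with
  | _ v ih =>
    by_cases hvi : v = i
    · subst hvi
      exact iff_of_true ⟨0, rfl⟩ (color_of_lt p hi)
    have hstep : (∃ k, p^[k] v = i) ↔ ∃ k, p^[k] (p v) = i := by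
      constructor
      · rintro ⟨k, hk⟩
        cases k with
        | zero => exact absurd hk hvi
        | succ k => exact ⟨k, by simpa using hk⟩
      · rintro ⟨k, hk⟩
        exact ⟨k + 1, by simpa using hk⟩
    rcases Nat.eq_zero_or_pos v with rfl | hpos
    · rw [color_of_lt p (by omega)]
      refine iff_of_false ?_ hvi
      rintro ⟨k, hk⟩
      exact hvi ((Function.iterate_fixed h0 k).symm.trans hk)
    have hlt := h1 v hpos hv
    rw [hstep, ih (p v) hlt (by omega)]
    rcases lt_or_ge v m with hvm | hvm
    · rw [color_of_lt p hvm, color_of_lt p (by omega)]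
      refine iff_of_false (fun h => ?_) hvi
      exact hleaf v (by omega) hvm h
    · rw [color_of_le hvm hlt]

/-! ### Distinct sizes at late leaves -/

/-- The least element of each fibre injects into the image; every other element is the first entry
of a colliding pair. -/
theorem card_le_card_image_add {α β : Type*} [DecidableEq β] [LinearOrder α] (s : Finset α)
    (f : α → β) :
    #s ≤ #(s.image f) + #{x ∈ s.offDiag | f x.1 = f x.2} := by
  set r := {x ∈ s | ∀ y ∈ s, y < x → f y ≠ f x} with hr
  have h1 : #r ≤ #(s.image f) := by
    rw [← card_image_of_injOn (s := r) (f := f)]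
    · exact card_le_card (image_subset_image (filter_subset _ _))
    · intro x hx y hy hxy
      simp only [hr, coe_filter, Set.mem_ofPred_eq] at hx hy
      rcases lt_trichotomy x y with h | h | h
      · exact absurd hxy (hy.2 x hx.1 h)
      · exact h
      · exact absurd hxy.symm (hx.2 y hy.1 h)
  have h2 : #(s \ r) ≤ #{x ∈ s.offDiag | f x.1 = f x.2} := by
    refine (card_le_card fun x hx => ?_).trans (card_image_le (f := Prod.fst))
    simp only [hr, mem_sdiff, mem_filter, not_and, not_forall, not_not] at hx
    obtain ⟨hx, h⟩ := hx
    obtain ⟨y, hy, hyx, hf⟩ := h hx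
    exact mem_image.2 ⟨(x, y), by simp [hx, hy, hyx.ne', hf], rfl⟩
  have h3 := card_sdiff_add_card_eq_card (show r ⊆ s from filter_subset _ _)
  omega

open Classical in
/-- The nodes in `[h, 2h)` that are leaves once `2h` nodes are present. -/
noncomputable def lateLeaves (h : ℕ) (p : ℕ → ℕ) : Finset ℕ :=
  {i ∈ Ico h (2 * h) | ∀ w, i < w → w < 2 * h → p w ≠ i}

theorem card_attachSeqs_mul_le_sum_card_lateLeaves {n h : ℕ} (hh : 1 ≤ h) (hn : 2 * h ≤ n + 1) :
    n.factorial * h ≤ 2 * ∑ p ∈ attachSeqs n, #(lateLeaves h p) := by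
  classical
  simp only [lateLeaves, card_filter]
  rw [sum_comm, mul_sum]
  simp only [← card_filter]
  calc n.factorial * h = ∑ i ∈ Ico h (2 * h), n.factorial := by
        rw [sum_const, Nat.card_Ico, smul_eq_mul, mul_comm]; congr 1; omega
    _ ≤ _ := by
        refine sum_le_sum fun i hi => ?_
        rw [mem_Ico] at hi
        have h1 := card_childless n le_rfl (show i ≤ 2 * h - 1 by omega) (by omega)
        have h2 : #{p ∈ attachSeqs n | ∀ w, i < w → w ≤ 2 * h - 1 → p w ≠ i} =
            #{p ∈ attachSeqs n | ∀ w, i < w → w < 2 * h → p w ≠ i} := by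
          congr 1
          refine filter_congr fun p _ => forall_congr' fun w => imp_congr_right fun _ => ?_
          rw [show w ≤ 2 * h - 1 ↔ w < 2 * h by omega]
        rw [h2] at h1
        refine Nat.le_of_mul_le_mul_right (c := h) ?_ (by omega)
        calc n.factorial * h ≤ n.factorial * i := Nat.mul_le_mul_left _ hi.1
          _ = _ := h1.symm
          _ ≤ _ * (2 * h) := Nat.mul_le_mul_left _ (by omega)
          _ = _ := by ring

theorem sum_card_collisions_le {n h : ℕ} (hh : 2 ≤ h) (hn : 2 * h ≤ n + 1) :
    (∑ p ∈ attachSeqs n, #{x ∈ (lateLeaves h p).offDiag |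
      blockSize (2 * h) n p x.1 = blockSize (2 * h) n p x.2}) * n ≤
      h ^ 2 * (n.factorial * (2 * h - 1)) := by
  classical
  have h1 : ∀ p ∈ attachSeqs n, #{x ∈ (lateLeaves h p).offDiag |
      blockSize (2 * h) n p x.1 = blockSize (2 * h) n p x.2} ≤
      #{x ∈ (Ico h (2 * h)).offDiag |
      blockSize (2 * h) n p x.1 = blockSize (2 * h) n p x.2} := fun p _ =>
    card_le_card (filter_subset_filter _ (offDiag_mono (filter_subset _ _)))
  refine (Nat.mul_le_mul_right n (sum_le_sum h1)).trans ?_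
  simp only [card_filter]
  rw [sum_comm]
  simp only [← card_filter]
  rw [sum_mul]
  refine (sum_le_card_nsmul _ _ (n.factorial * (2 * h - 1)) fun x hx => ?_).trans ?_
  · simp only [mem_offDiag, mem_Ico] at hx
    exact card_collision_le (by omega) (by omega) hn (by omega) hx.2.2
  · rw [smul_eq_mul, offDiag_card, Nat.card_Ico, show 2 * h - h = h by omega, sq]
    exact Nat.mul_le_mul_right _ (Nat.sub_le _ _)

/-- On average, the late leaves root fringe subtrees of at least `h / 4` different sizes. -/
theorem factorial_mul_le_sum_card_sizes {n h : ℕ} (hh : 2 ≤ h) (hn : 16 * h ^ 2 ≤ n + 1) :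
    n.factorial * h ≤
      4 * ∑ p ∈ attachSeqs n, #((lateLeaves h p).image (blockSize (2 * h) n p)) := by
  have h2n : 2 * h ≤ n + 1 := by nlinarith
  have h1 := card_attachSeqs_mul_le_sum_card_lateLeaves (by omega : 1 ≤ h) h2n
  have h2 := sum_card_collisions_le hh h2n
  have h3 := sum_le_sum fun p (_ : p ∈ attachSeqs n) =>
    card_le_card_image_add (lateLeaves h p) (blockSize (2 * h) n p)
  rw [sum_add_distrib] at h3
  set C := ∑ p ∈ attachSeqs n, #{x ∈ (lateLeaves h p).offDiag |
      blockSize (2 * h) n p x.1 = blockSize (2 * h) n p x.2}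
  -- At most `h/4` collisions on average, half of the guaranteed `h/2` leaves.
  have h4 : 4 * C ≤ n.factorial * h := by
    refine Nat.le_of_mul_le_mul_right (c := n) ?_ (by nlinarith)
    have h5 : 4 * (h * (2 * h - 1)) ≤ n := by
      obtain ⟨d, rfl⟩ := Nat.exists_eq_add_of_le hh
      have : 2 * (2 + d) - 1 = 2 * d + 3 := by omega
      rw [this]
      nlinarith
    calc 4 * C * n = 4 * (C * n) := by ring
      _ ≤ 4 * (h ^ 2 * (n.factorial * (2 * h - 1))) := Nat.mul_le_mul_left _ h2
      _ = n.factorial * h * (4 * (h * (2 * h - 1))) := by ring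
      _ ≤ _ := Nat.mul_le_mul_left _ h5
  omega
-- Recursive trees as attachment sequences
namespace RecursiveTree

/-- The parent map of a recursive tree as a map on natural numbers, zero outside the tree. -/
def parentSeq {n : ℕ} (τ : RecursiveTree n) (v : ℕ) : ℕ :=
  if h : v < n then τ.1.parent ⟨v, h⟩ else 0

theorem parentSeq_coe {n : ℕ} (τ : RecursiveTree n) (v : Fin n) :
    parentSeq τ v = τ.1.parent v := by
  simp [parentSeq]

theorem root_eq {n : ℕ} (τ : RecursiveTree (n + 1)) : τ.1.root = 0 := by
  by_contra h
  exact (Fin.zero_le _).not_gt (τ.2 0 fun h' => h h'.symm)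

theorem parentSeq_mem {n : ℕ} (τ : RecursiveTree (n + 1)) : parentSeq τ ∈ attachSeqs n := by
  refine mem_attachSeqs.2 ⟨?_, fun v hv hvn => ?_, fun v hv => ?_⟩
  · have h := parentSeq_coe τ 0
    have h0 := τ.1.parent_root
    rw [root_eq] at h0
    rw [h0] at h
    exact h
  · have h := τ.2 ⟨v, by omega⟩ (by
      rw [root_eq]
      intro h
      have := congrArg Fin.val h
      simp at this
      omega)
    rw [parentSeq, dif_pos (by omega)]
    exact h
  · rw [parentSeq, dif_neg (by omega)]

theorem parentSeq_injective (n : ℕ) :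
    Function.Injective (parentSeq : RecursiveTree (n + 1) → ℕ → ℕ) := by
  intro τ τ' h
  refine Subtype.ext (ParentTree.ext ((root_eq τ).trans (root_eq τ').symm) (funext fun v => ?_))
  exact Fin.ext (by rw [← parentSeq_coe, ← parentSeq_coe, h])

theorem exists_parentSeq_eq {n : ℕ} {p : ℕ → ℕ} (hp : p ∈ attachSeqs n) :
    ∃ τ : RecursiveTree (n + 1), parentSeq τ = p := by
  obtain ⟨h0, h1, h2⟩ := mem_attachSeqs.1 hp
  have hle : ∀ v ≤ n, p v ≤ v := fun v hv => by
    rcases Nat.eq_zero_or_pos v with rfl | h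
    · exact h0.le
    · exact (h1 v h hv).le
  let f : Fin (n + 1) → Fin (n + 1) := fun v =>
    ⟨p v, (hle v (Nat.le_of_lt_succ v.2)).trans_lt v.2⟩
  have hf0 : f 0 = 0 := Fin.ext h0
  have hreach : ∀ k : ℕ, ∀ v : Fin (n + 1), (v : ℕ) = k → ∃ m : ℕ, f^[m] v = 0 := by
    intro k
    induction k using Nat.strong_induction_on with
    | _ k ih =>
      rintro v rfl
      rcases Nat.eq_zero_or_pos (v : ℕ) with h | h
      · exact ⟨0, Fin.ext h⟩
      · obtain ⟨m, hm⟩ := ih (p v) (h1 v h (Nat.le_of_lt_succ v.2)) (f v) rfl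
        exact ⟨m + 1, hm⟩
  refine ⟨⟨⟨0, f, hf0, fun v => hreach v v rfl⟩, fun v hv => ?_⟩, funext fun v => ?_⟩
  · exact h1 v (Nat.pos_of_ne_zero fun h => hv (Fin.ext h)) (Nat.le_of_lt_succ v.2)
  · unfold parentSeq
    split_ifs with h
    · rfl
    · exact (h2 v (by omega)).symm

theorem sum_parentSeq {M : Type*} [AddCommMonoid M] (n : ℕ) (g : (ℕ → ℕ) → M) :
    ∑ τ : RecursiveTree (n + 1), g (parentSeq τ) = ∑ p ∈ attachSeqs n, g p :=
  sum_bij (fun τ _ => parentSeq τ) (fun τ _ => parentSeq_mem τ)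
    (fun _ _ _ _ h => parentSeq_injective n h)
    (fun _ hp => (exists_parentSeq_eq hp).imp fun _ h => ⟨mem_univ _, h⟩) fun _ _ => rfl

theorem natCard_eq_factorial (n : ℕ) : Nat.card (RecursiveTree (n + 1)) = n.factorial := by
  rw [Nat.card_eq_fintype_card, ← card_univ, card_eq_sum_ones, sum_parentSeq n fun _ => 1,
    ← card_eq_sum_ones, card_attachSeqs]

theorem coe_iterate_parent {n : ℕ} (τ : RecursiveTree n) (k : ℕ) (v : Fin n) :
    ((τ.1.parent^[k] v : Fin n) : ℕ) = (parentSeq τ)^[k] v := by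
  induction k generalizing v with
  | zero => rfl
  | succ k ih => rw [Function.iterate_succ_apply, ih, Function.iterate_succ_apply, parentSeq_coe]

theorem size_shape_fringe {n : ℕ} (τ : RecursiveTree n) (v : Fin n) :
    (τ.1.fringe v).shape.size = Nat.card (τ.1.Descendant v) := rfl

theorem size_shape_fringe_eq_blockSize {n m : ℕ} (τ : RecursiveTree (n + 1)) (i : Fin (n + 1))
    (hi : (i : ℕ) < m) (hleaf : ∀ w, (i : ℕ) < w → w < m → parentSeq τ w ≠ i) :
    (τ.1.fringe i).shape.size = blockSize m n (parentSeq τ) i := by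
  classical
  have hiff : ∀ u : Fin (n + 1),
      (∃ k : ℕ, τ.1.parent^[k] u = i) ↔ color m (parentSeq τ) u = i := by
    intro u
    rw [← exists_iterate_eq_iff_color (parentSeq_mem τ) hi hleaf (Nat.le_of_lt_succ u.2)]
    simp only [← coe_iterate_parent, Fin.val_inj]
  rw [size_shape_fringe, Nat.card_congr (Equiv.subtypeEquivRight hiff),
    Nat.card_eq_fintype_card, Fintype.card_subtype, blockSize, card_filter, card_filter,
    Fin.sum_univ_eq_sum_range fun u => if color m (parentSeq τ) u = i then 1 else 0]

end RecursiveTree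

open RecursiveTree

/-! ### Expected number of shapes -/

theorem Occurs.mem_polyaTreesLE {n : ℕ} {t : PolyaTree} {τ : RecursiveTree n} (h : Occurs t τ) :
    t ∈ polyaTreesLE n := by
  obtain ⟨v, rfl⟩ := h
  refine mem_sigma.2 ⟨mem_range.2 (Nat.lt_succ_of_le ?_), mem_univ _⟩
  exact (Finite.card_subtype_le _).trans (Nat.card_fin n).le

open Classical in
theorem compactedSize_eq_card {n : ℕ} (τ : RecursiveTree n) :
    compactedSize τ = #{t ∈ polyaTreesLE n | Occurs t τ} := by
  rw [compactedSize, ← Set.ncard_coe_finset]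
  congr 1
  ext t
  simpa using fun h : Occurs t τ => h.mem_polyaTreesLE

open Classical in
theorem shapeContribution_eq (n : ℕ) (t : PolyaTree) :
    shapeContribution (n + 1) t =
      (#{τ : RecursiveTree (n + 1) | Occurs t τ} : ℝ) / (n.factorial : ℝ) := by
  have hcard := natCard_eq_factorial n
  have h1 : (Nat.card {τ : RecursiveTree (n + 1) // ¬ Occurs t τ} : ℝ) =
      n.factorial - #{τ : RecursiveTree (n + 1) | Occurs t τ} := by
    rw [Nat.card_eq_fintype_card, Fintype.card_subtype, eq_sub_iff_add_eq, add_comm]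
    rw [Nat.card_eq_fintype_card, ← card_univ] at hcard
    rw [← hcard]
    exact_mod_cast card_filter_add_card_filter_not _
  have h2 : ((n + 1).factorial : ℝ) ≠ 0 := by positivity
  have h3 : (n.factorial : ℝ) ≠ 0 := by positivity
  rw [shapeContribution, avoidingEGF, recursiveEGF, PowerSeries.coeff_mk, PowerSeries.coeff_mk,
    h1, hcard, div_div_div_cancel_right₀ h2, sub_div, div_self h3, sub_sub_cancel]

open Classical in
theorem sum_filter_shapeContribution (n : ℕ) (P : PolyaTree → Prop) :
    ∑ t ∈ (polyaTreesLE (n + 1)).filter P, shapeContribution (n + 1) t =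
      (∑ τ : RecursiveTree (n + 1), (#{t ∈ (polyaTreesLE (n + 1)).filter P | Occurs t τ} : ℝ)) /
        n.factorial := by
  simp only [shapeContribution_eq, ← sum_div, card_filter, Nat.cast_sum]
  rw [sum_comm]

theorem expectedCompactedSize_eq_add (n : ℕ) (hn : 1 ≤ n) :
    expectedCompactedSize n = smallShapeSum n + largeShapeSum n := by
  classical
  obtain ⟨n, rfl⟩ := Nat.exists_eq_add_of_le' hn
  have h := sum_filter_shapeContribution n fun _ => True
  rw [smallShapeSum, largeShapeSum]
  simp only [← not_lt]
  rw [sum_filter_add_sum_filter_not]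
  simp only [filter_true] at h
  rw [h, expectedCompactedSize, natCard_eq_factorial]
  simp only [compactedSize_eq_card]

theorem smallShapeSum_nonneg (n : ℕ) (hn : 1 ≤ n) : 0 ≤ smallShapeSum n := by
  classical
  obtain ⟨n, rfl⟩ := Nat.exists_eq_add_of_le' hn
  refine sum_nonneg fun t _ => ?_
  rw [shapeContribution_eq]
  positivity

/-! ### Lower bound for the large shapes -/

/-- A recursive tree has at least as many large fringe shapes as its late leaves have different
subtree sizes, up to the number of sizes that are not large. -/
theorem card_image_blockSize_le {n h : ℕ} (hn : 2 * h ≤ n + 1) (τ : RecursiveTree (n + 1)) (L : ℕ)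
    (P : PolyaTree → Prop) [DecidablePred P] [DecidablePred fun t => Occurs t τ]
    (hP : ∀ t : PolyaTree, L ≤ t.size → P t) :
    #((lateLeaves h (parentSeq τ)).image (blockSize (2 * h) n (parentSeq τ))) ≤
      #{t ∈ (polyaTreesLE (n + 1)).filter P | Occurs t τ} + L := by
  have hsub : (lateLeaves h (parentSeq τ)).image (blockSize (2 * h) n (parentSeq τ)) ⊆
      ({t ∈ (polyaTreesLE (n + 1)).filter P | Occurs t τ}).image PolyaTree.size ∪ range L := by
    intro k hk
    obtain ⟨i, hi, rfl⟩ := mem_image.1 hk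
    simp only [lateLeaves, mem_filter, mem_Ico] at hi
    rw [mem_union, mem_range]
    refine (lt_or_ge _ L).symm.imp_left fun hL => ?_
    have hs := size_shape_fringe_eq_blockSize τ ⟨i, by omega⟩ hi.1.2 hi.2
    have ho : Occurs (τ.1.fringe ⟨i, by omega⟩).shape τ := ⟨_, rfl⟩
    refine mem_image.2 ⟨_, ?_, hs⟩
    exact mem_filter.2 ⟨mem_filter.2 ⟨ho.mem_polyaTreesLE, hP _ (hs ▸ hL)⟩, ho⟩
  calc _ ≤ _ := card_le_card hsub
    _ ≤ _ := card_union_le _ _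
    _ ≤ _ := by
      rw [card_range]
      exact Nat.add_le_add_right card_image_le L

theorem le_largeShapeSum {n h : ℕ} (hh : 2 ≤ h) (hn : 16 * h ^ 2 ≤ n + 1) :
    (h : ℝ) / 4 - ⌈polyaLog (n + 1 : ℕ)⌉₊ ≤ largeShapeSum (n + 1) := by
  classical
  have hfac : (0 : ℝ) < n.factorial := by positivity
  rw [largeShapeSum, sum_filter_shapeContribution, le_div_iff₀ hfac]
  set L := ⌈polyaLog (n + 1 : ℕ)⌉₊
  have h1 := factorial_mul_le_sum_card_sizes hh hn
  rw [← sum_parentSeq] at h1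
  have h2 := sum_le_sum fun τ (_ : τ ∈ (univ : Finset (RecursiveTree (n + 1)))) =>
    card_image_blockSize_le (by nlinarith : 2 * h ≤ n + 1) τ L
      (fun t => polyaLog (n + 1 : ℕ) ≤ (t.size : ℝ)) fun t ht => Nat.ceil_le.1 ht
  rw [sum_add_distrib, sum_const, card_univ, ← Nat.card_eq_fintype_card, natCard_eq_factorial,
    smul_eq_mul] at h2
  have h3 := h1.trans (Nat.mul_le_mul_left 4 h2)
  have h4 : (n.factorial * h : ℝ) ≤ 4 * ((∑ τ : RecursiveTree (n + 1),
      (#{t ∈ {t ∈ polyaTreesLE (n + 1) | polyaLog (n + 1 : ℕ) ≤ (t.size : ℝ)} | Occurs t τ} : ℝ)) +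
      n.factorial * L) := by exact_mod_cast h3
  linarith

/-- Changing the base only rescales the logarithm by a constant, so nothing about the value of
`polyaSingularity` is needed. -/
theorem polyaLog_isLittleO : (fun n : ℕ => polyaLog n) =o[Filter.atTop] fun n : ℕ => √(n : ℝ) := by
  have h := (isLittleO_log_rpow_atTop (r := 1 / 2) (by norm_num)).comp_tendsto
    (tendsto_natCast_atTop_atTop (R := ℝ))
  simp only [Function.comp_def, ← Real.sqrt_eq_rpow] at h
  exact (h.const_mul_left (Real.log (1 / polyaSingularity))⁻¹).congr_left fun n => by
    exact (div_eq_inv_mul _ _).symm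

theorem exists_sqrt_le_largeShapeSum :
    ∃ c : ℝ, 0 < c ∧ ∃ N : ℕ, ∀ n : ℕ, N ≤ n → c * Real.sqrt n ≤ largeShapeSum n := by
  obtain ⟨N, hN⟩ := Filter.eventually_atTop.1
    (polyaLog_isLittleO.bound (by norm_num : (0 : ℝ) < 1 / 64))
  -- With `s = √n` and `h = ⌊s/4⌋`, the bound is at least `(s/4 - 1)/4 - (s/64 + 1)`, which exceeds
  -- `s/64` once `s ≥ 40`; `n ≥ 10000` gives `s ≥ 100`.
  refine ⟨1 / 64, by norm_num, max N 10000, fun n hn => ?_⟩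
  have hlog := (le_abs_self _).trans (hN n ((le_max_left _ _).trans hn))
  rw [Real.norm_eq_abs, abs_of_nonneg (Real.sqrt_nonneg _)] at hlog
  have hn' : 10000 ≤ n := (le_max_right _ _).trans hn
  have hs : (100 : ℝ) ≤ √n := Real.le_sqrt_of_sq_le (by norm_num; exact_mod_cast hn')
  have hsq : √(n : ℝ) ^ 2 = n := Real.sq_sqrt (Nat.cast_nonneg n)
  obtain ⟨m, rfl⟩ := Nat.exists_eq_add_of_le' (show 1 ≤ n by omega)
  set s := √((m + 1 : ℕ) : ℝ)
  have hh1 := Nat.floor_le (show 0 ≤ s / 4 by positivity)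
  have hh2 := Nat.lt_floor_add_one (s / 4)
  set h := ⌊s / 4⌋₊
  have hceil : (⌈polyaLog (m + 1 : ℕ)⌉₊ : ℝ) ≤ s / 64 + 1 :=
    (Nat.cast_le.2 (Nat.ceil_mono (show _ ≤ s / 64 by linarith))).trans
      (Nat.ceil_lt_add_one (by positivity)).le
  have key := le_largeShapeSum (n := m) (h := h)
    (by have : (1 : ℝ) < h := by linarith
        exact_mod_cast this)
    (by have : (16 * h ^ 2 : ℝ) ≤ (m + 1 : ℕ) := by
          refine le_trans ?_ hsq.le
          calc (16 * h ^ 2 : ℝ) ≤ 16 * (s / 4) ^ 2 := by gcongr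
            _ = s ^ 2 := by ring
        exact_mod_cast this)
  linarith

theorem mainTheorem3 :
    (∀ n : ℕ, 1 ≤ n → expectedCompactedSize n = smallShapeSum n + largeShapeSum n) ∧
    (∃ c : ℝ, 0 < c ∧ ∃ N : ℕ, ∀ n : ℕ, N ≤ n → c * Real.sqrt n ≤ largeShapeSum n) ∧
    (∃ c : ℝ, 0 < c ∧ ∃ N : ℕ, ∀ n : ℕ, N ≤ n → c * Real.sqrt n ≤ expectedCompactedSize n) := by
  refine ⟨expectedCompactedSize_eq_add, exists_sqrt_le_largeShapeSum, ?_⟩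
  obtain ⟨c, hc, N, hN⟩ := exists_sqrt_le_largeShapeSum
  refine ⟨c, hc, max N 1, fun n hn => ?_⟩
  have h1 : 1 ≤ n := (le_max_right _ _).trans hn
  rw [expectedCompactedSize_eq_add n h1]
  linarith [hN n ((le_max_left _ _).trans hn), smallShapeSum_nonneg n h1]
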